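/- **Conventions.** For a set $C$ of ordinals, $\mathrm{acc}(C)$ is the set of nonzero $\alpha\in C$ with $\alpha=\sup(C\cap\alpha)$, and $\mathrm{nacc}(C)=C\setminus\mathrm{acc}(C)$. A strict $S$-club system is a sequence $\bar C=\langle C_\delta:\delta\in S\rangle$ in which each $C_\delta$ is a closed unbounded subset of $\delta$ of order type $\mathrm{cf}(\delta)$. $J^{bd}_{C}$ is the ideal of bounded subsets of $C$, and $J^{bd}_{C}+\mathrm{acc}(C)$ is the ideal on $C$ consisting of the $A\subseteq C$ with $A\setminus\mathrm{acc}(C)$ bounded in $C$. For a family $\bar J=\langle J_\delta:\delta\in S\rangle$ of ideals $J_\delta$ on $C_\delta$, $\mathrm{id}^p(\bar C,\bar J)$ is the family of all $A\subseteq\lambda^+$ for which there is a club $E$ of $\lambda^+$ with $E\cap C_\delta\in J_\delta$ for every $\delta\in S\cap A$; and $\mathrm{id}^p(\bar C)=\mathrm{id}^p(\bar C,\langle J^{bd}_{C_\delta}+\mathrm{acc}(C_\delta):\delta\in S\rangle)$. An ideal is $\lambda$-complete if it is closed under unions of fewer than $\lambda$ of its members. **Claim.** Let $\mu$ be an infinite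 cardinal, $\lambda=\mu^+$, and let $S\subseteq\{\delta<\lambda^+:\mathrm{cf}(\delta)=\lambda$ and $\delta$ is divisible by the ordinal $\lambda^2\}$ be stationary in $\lambda^+$. (1) There is a strict $S$-club system $\bar C=\langle C_\delta:\delta\in S\rangle$ such that $\lambda^+\notin\mathrm{id}^p(\bar C)$ and, for every $\delta\in S$, every $\alpha\in\mathrm{nacc}(C_\delta)$ has cofinality $\lambda$; moreover, there are functions $h_\delta:C_\delta\to\mu$ $(\delta\in S)$ such that for every club $E$ of $\lambda^+$, for stationarily many $\delta\in S$, for every $\zeta<\mu$, $$\delta=\sup\bigl(h_\delta^{-1}(\{\zeta\})\cap E\cap\mathrm{nacc}(C_\delta)\bigr).$$ (2) Suppose $\bar C$ is a strict $S$-club system and, for each $\delta\in S$, $J_\delta$ is a $\lambda$-complete ideal on $C_\delta$ extending $J^{bd}_{C_\delta}+\mathrm{acc}(C_\delta)$, and suppose $\lambda^+\notin\mathrm{id}^p(\bar C,\bar J)$. Then there are functions $h_\delta:C_\delta\to\mu$ $(\delta\in S)$ such that for every club $E$ of $\lambda^+$, for stationarily many $\delta\in S\cap\mathrm{acc}(E)$,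 for every $\gamma<\mu$, $$\{\alpha\in C_\delta:h_\delta(\alpha)=\gamma\text{ and }\alpha\in E\}\notin J_\delta.$$ -/

import Mathlib

open Set

universe u

namespace ClubGuess

/-- `C` is a closed unbounded subset of the ordinal `o`. -/
def IsClubIn (C : Set Ordinal.{u}) (o : Ordinal.{u}) : Prop :=
  C ⊆ Iio o ∧ IsClub (Subtype.val ⁻¹' C : Set (Iio o))

/-- `S` is a stationary subset of the ordinal `o`. -/
def IsStationaryIn (S : Set Ordinal.{u}) (o : Ordinal.{u}) : Prop :=
  S ⊆ Iio o ∧ IsStationary (Subtype.val ⁻¹' S : Set (Iio o))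

/-- The accumulation points of `C` that belong to `C`: the nonzero `α ∈ C` with
`α = sup (C ∩ α)`. -/
def acc (C : Set Ordinal.{u}) : Set Ordinal.{u} :=
  {α | α ∈ C ∧ α ≠ 0 ∧ IsLUB (C ∩ Iio α) α}

/-- The nonaccumulation points of `C`. -/
def nacc (C : Set Ordinal.{u}) : Set Ordinal.{u} :=
  C \ acc C

/-- `⟨C δ : δ ∈ S⟩` is a strict `S`-club system: `C δ` is a club of `δ` whose order type is the
cofinality of `δ`. The values `C δ` for `δ ∉ S` are irrelevant. -/
def IsStrictClubSystem (S : Set Ordinal.{u}) (C : Ordinal.{u} → Set Ordinal.{u}) : Prop :=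
  ∀ δ ∈ S, IsClubIn (C δ) δ ∧ Nonempty (Iio δ.cof.ord ≃o C δ)

/-- `J` is a `κ`-complete ideal of subsets of `X`: it is closed under subsets and under unions of
fewer than `κ` members. (The empty union gives `∅ ∈ J`; `J` is allowed to be improper.) -/
structure IsCompleteIdealOn (κ : Cardinal.{u}) (X : Set Ordinal.{u})
    (J : Set (Set Ordinal.{u})) : Prop where
  subset_carrier : ∀ A ∈ J, A ⊆ X
  mem_of_subset : ∀ A ∈ J, ∀ B, B ⊆ A → B ∈ J
  iUnion_mem : ∀ (ι : Type u) (f : ι → Set Ordinal.{u}), Cardinal.mk ι < κ →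
    (∀ i, f i ∈ J) → (⋃ i, f i) ∈ J

/-- The ideal of bounded subsets of `C` (for `C` without a last element). -/
def bddIdeal (C : Set Ordinal.{u}) : Set (Set Ordinal.{u}) :=
  {A | A ⊆ C ∧ ∃ β ∈ C, ∀ α ∈ A, α < β}

/-- The ideal of subsets of `C` generated by the bounded subsets together with `acc C`. -/
def bddAccIdeal (C : Set Ordinal.{u}) : Set (Set Ordinal.{u}) :=
  {A | A ⊆ C ∧ A \ acc C ∈ bddIdeal C}

/-- The ideal `id^p(⟨C δ : δ ∈ S⟩, ⟨J δ : δ ∈ S⟩)` on `θ`: the sets `A ⊆ θ` such that, for some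
club `E` of `θ`, `E ∩ C δ ∈ J δ` for every `δ ∈ S ∩ A`. -/
def idp (θ : Ordinal.{u}) (S : Set Ordinal.{u}) (C : Ordinal.{u} → Set Ordinal.{u})
    (J : Ordinal.{u} → Set (Set Ordinal.{u})) : Set (Set Ordinal.{u}) :=
  {A | A ⊆ Iio θ ∧ ∃ E, IsClubIn E θ ∧ ∀ δ ∈ S ∩ A, E ∩ C δ ∈ J δ}

end ClubGuess

namespace ClubGuess

open Cardinal Ordinal

/-! ### Clubs and stationary sets of ordinals -/

/-! Part (2), `exists_coloring_positive`, is by contradiction. Enumerate `C δ` in type λ and form an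
Ulam matrix B(ζ, ξ), ζ < μ, ξ < λ: each row ζ is disjoint, and each column ξ covers a tail of `C δ`.
If no colouring works, any disjoint family of fewer than λ sets has fewer than μ positive members on
some club (`exists_club_few_positive`): otherwise iterating the failure λ times kills a new member
at each stage. Intersect the clubs obtained for all rows and all bounds η < λ on ξ, and take δ
positive for the intersection. By λ-completeness every column has a positive entry, so by pigeonhole
one row has μ of them below some η, a contradiction.

Part (1) needs a system guessing clubs at points of cofinality λ; then (2) applies to the ideals
`bddAccIdeal (C δ)`. To build it, project a thin cofinal subset of δ to a club E and, while the
projection has cofinality below λ, step down a short ladder and project again. Fewer than λ points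
are reached from each start. If no E worked, an ω-chain of counterexample clubs would arise;
projections can decrease only finitely often, so they stabilise along the chain, at a point that
refutes one of the counterexamples (`exists_club_reachable_guessing`). Closing off the reached
points gives the strict clubs. -/

theorem isClubIn_iff {C : Set Ordinal.{u}} {o : Ordinal.{u}} :
    IsClubIn C o ↔ C ⊆ Iio o ∧ (∀ β < o, ∃ α ∈ C, β ≤ α) ∧
      ∀ t ⊆ C, t.Nonempty → ∀ β < o, IsLUB t β → β ∈ C := by
  unfold IsClubIn
  refine and_congr_right fun hC => ⟨fun h => ⟨fun β hβ => ?_, fun t ht hne β hβ hlub => ?_⟩,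
    fun h => ⟨fun d hd hne _ a ha => ?_, fun x => ?_⟩⟩
  · obtain ⟨y, hy, hxy⟩ := h.isCofinal ⟨β, hβ⟩
    exact ⟨y, hy, hxy⟩
  · have : (⟨β, hβ⟩ : Iio o) ∈ (Subtype.val ⁻¹' C : Set (Iio o)) := by
      refine h.isLUB_mem (t := Subtype.val ⁻¹' t) (fun x hx => ht hx) ?_ ⟨?_, ?_⟩
      · obtain ⟨x, hx⟩ := hne
        exact ⟨⟨x, hC (ht hx)⟩, hx⟩
      · exact fun x hx => hlub.1 hx
      · exact fun b hb => hlub.2 fun x hx => hb (a := ⟨x, hC (ht hx)⟩) hx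
    exact this
  · refine h.2 (Subtype.val '' d) ?_ (hne.image _) a.1 a.2 ⟨?_, ?_⟩
    · rintro _ ⟨x, hx, rfl⟩
      exact hd hx
    · rintro _ ⟨x, hx, rfl⟩
      exact ha.1 hx
    · intro b hb
      by_contra! hlt
      have : a ≤ ⟨b, hlt.trans a.2⟩ := ha.2 fun x hx => hb ⟨x, hx, rfl⟩
      exact absurd hlt (not_lt.2 this)
  · obtain ⟨α, hα, hle⟩ := h.1 x.1 x.2
    exact ⟨⟨α, hC hα⟩, hα, hle⟩

theorem IsClubIn.exists_ge {C : Set Ordinal.{u}} {o : Ordinal.{u}} (h : IsClubIn C o) :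
    ∀ β < o, ∃ α ∈ C, β ≤ α :=
  (isClubIn_iff.1 h).2.1

theorem IsClubIn.mem_of_isLUB {C : Set Ordinal.{u}} {o : Ordinal.{u}} (h : IsClubIn C o)
    {t : Set Ordinal.{u}} (ht : t ⊆ C) (hne : t.Nonempty) {β : Ordinal.{u}} (hβ : β < o)
    (hlub : IsLUB t β) : β ∈ C :=
  (isClubIn_iff.1 h).2.2 t ht hne β hβ hlub

theorem cof_Iio_ord {κ : Cardinal.{u}} (hκ : κ.IsRegular) :
    Order.cof (Iio κ.ord) = Cardinal.lift.{u + 1} κ := by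
  rw [Ordinal.cof_Iio, ← Ordinal.lift_cof, hκ.cof_ord]

theorem aleph0_ne_lift {κ : Cardinal.{u}} (hκ : ℵ₀ < κ) : Cardinal.lift.{u + 1} κ ≠ ℵ₀ := by
  have : ℵ₀ < Cardinal.lift.{u + 1} κ := by simpa using hκ
  exact this.ne'

theorem isClubIn_iInter {κ : Cardinal.{u}} (hκ : κ.IsRegular) (hκ' : ℵ₀ < κ) {ι : Type (u + 1)}
    (hι : #ι < Cardinal.lift.{u + 1} κ) {f : ι → Set Ordinal.{u}}
    (hf : ∀ i, IsClubIn (f i) κ.ord) : IsClubIn (Iio κ.ord ∩ ⋂ i, f i) κ.ord := by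
  refine ⟨inter_subset_left, ?_⟩
  have h := IsClub.iInter (α := Iio κ.ord) (f := fun i => Subtype.val ⁻¹' f i)
    (by rw [cof_Iio_ord hκ]; exact aleph0_ne_lift hκ')
    (by rw [cof_Iio_ord hκ]; simpa using hι) fun i => (hf i).2
  convert h using 1
  ext x
  simp

theorem IsClubIn.inter {κ : Cardinal.{u}} (hκ : κ.IsRegular) (hκ' : ℵ₀ < κ)
    {C D : Set Ordinal.{u}} (hC : IsClubIn C κ.ord) (hD : IsClubIn D κ.ord) :
    IsClubIn (C ∩ D) κ.ord := by
  refine ⟨inter_subset_left.trans hC.1, ?_⟩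
  rw [preimage_inter]
  exact hC.2.inter (by rw [cof_Iio_ord hκ]; exact aleph0_ne_lift hκ') hD.2

theorem IsStationaryIn.exists_mem {S : Set Ordinal.{u}} {o : Ordinal.{u}} (hS : IsStationaryIn S o)
    {E : Set Ordinal.{u}} (hE : IsClubIn E o) : ∃ δ ∈ S, δ ∈ E := by
  obtain ⟨x, hx, hx'⟩ := hS.2 hE.2
  exact ⟨x, hx, hx'⟩

theorem isStationaryIn_iff {S : Set Ordinal.{u}} {o : Ordinal.{u}} :
    IsStationaryIn S o ↔ S ⊆ Iio o ∧ ∀ E, IsClubIn E o → ∃ δ ∈ S, δ ∈ E := by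
  refine ⟨fun h => ⟨h.1, fun E => h.exists_mem⟩, fun h => ⟨h.1, fun t ht => ?_⟩⟩
  obtain ⟨δ, hδ, hδ'⟩ := h.2 (Subtype.val '' t)
    ⟨by rintro _ ⟨x, -, rfl⟩; exact x.2, by rwa [preimage_image_eq _ Subtype.val_injective]⟩
  obtain ⟨x, hx, rfl⟩ := hδ'
  exact ⟨x, hδ, hx⟩

theorem isClubIn_Ico {o ε : Ordinal.{u}} (hε : ε < o) : IsClubIn (Ico ε o) o := by
  refine isClubIn_iff.2 ⟨fun _ h => h.2, fun β hβ => ⟨max β ε, ⟨le_max_right _ _, max_lt hβ hε⟩,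
    le_max_left _ _⟩, ?_⟩
  rintro t ht ⟨x, hx⟩ β hβ hlub
  exact ⟨(ht hx).1.trans (hlub.1 hx), hβ⟩

theorem acc_mono {C D : Set Ordinal.{u}} (h : C ⊆ D) : acc C ⊆ acc D := fun _ hα =>
  ⟨h hα.1, hα.2.1, fun _ hx => hx.2.le, fun _ hb => hα.2.2.2 fun _ hx => hb ⟨h hx.1, hx.2⟩⟩

theorem isLUB_iff_forall_lt {A : Set Ordinal.{u}} {δ : Ordinal.{u}} (hA : A ⊆ Iio δ) :
    IsLUB A δ ↔ ∀ β < δ, ∃ α ∈ A, β < α := by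
  refine ⟨fun h β hβ => (lt_isLUB_iff h).1 hβ, fun h => ⟨fun x hx => (hA hx).le, fun b hb => ?_⟩⟩
  by_contra! hlt
  obtain ⟨α, hα, hlt'⟩ := h b hlt
  exact absurd (hb hα) (not_le.2 hlt')

/-- The limit points of an unbounded subset of `κ` form a club. -/
theorem isClubIn_limits {κ : Cardinal.{u}} (hκ : κ.IsRegular) (hκ' : ℵ₀ < κ)
    {X : Set Ordinal.{u}} (hX : ∀ β < κ.ord, ∃ α ∈ X, β < α ∧ α < κ.ord) :
    IsClubIn {δ | δ < κ.ord ∧ ∀ β < δ, ∃ α ∈ X, β < α ∧ α < δ} κ.ord := by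
  refine isClubIn_iff.2 ⟨fun _ h => h.1, fun β hβ => ?_, fun t ht _ γ hγ hlub => ⟨hγ, fun b hb => ?_⟩⟩
  · have hX' : ∀ β, ∃ α, β < κ.ord → α ∈ X ∧ β < α ∧ α < κ.ord := fun β => by
      by_cases h : β < κ.ord
      · obtain ⟨α, h₁, h₂⟩ := hX β h
        exact ⟨α, fun _ => ⟨h₁, h₂⟩⟩
      · exact ⟨0, fun h' => absurd h' h⟩
    choose f hf using hX'
    have hlt : nfp f β < κ.ord :=
      nfp_lt_ord (by rwa [hκ.cof_ord]) (fun i hi => (hf i hi).2.2) hβ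
    refine ⟨nfp f β, ⟨hlt, fun b hb => ?_⟩, le_nfp f β⟩
    obtain ⟨n, hn⟩ := lt_nfp_iff.1 hb
    have hit : ∀ n, f^[n] β < κ.ord := fun n => (iterate_le_nfp f β n).trans_lt hlt
    refine ⟨f (f^[n] β), (hf _ (hit n)).1, hn.trans (hf _ (hit n)).2.1, ?_⟩
    -- One further iterate makes the inequality strict: the witness is itself the iterate of index
    -- `n + 1`.
    refine lt_nfp_iff.2 ⟨n + 1 + 1, ?_⟩
    rw [Function.iterate_succ_apply' f (n + 1), ← Function.iterate_succ_apply' f n]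
    exact (hf _ (hit (n + 1))).2.1
  · obtain ⟨δ, hδ, hlt⟩ := (lt_isLUB_iff hlub).1 hb
    obtain ⟨α, hα, h₁, h₂⟩ := (ht hδ).2 b hlt
    exact ⟨α, hα, h₁, h₂.trans_le (hlub.1 hδ)⟩

/-! ### Decreasing chains of clubs -/

/-- The decreasing chain of subsets of `o` obtained by iterating `G` and intersecting. -/
def clubChain (o : Ordinal.{u}) (G : Set Ordinal.{u} → Set Ordinal.{u}) (i : Ordinal.{u}) :
    Set Ordinal.{u} :=
  Iio o ∩ ⋂ j : Iio i, G (clubChain o G j.1)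
termination_by i
decreasing_by exact j.2

theorem clubChain_anti (o : Ordinal.{u}) (G : Set Ordinal.{u} → Set Ordinal.{u}) :
    Antitone (clubChain o G) := by
  intro i j hij x hx
  rw [clubChain] at hx ⊢
  exact ⟨hx.1, mem_iInter.2 fun k => mem_iInter.1 hx.2 ⟨k.1, lt_of_lt_of_le k.2 hij⟩⟩

theorem clubChain_subset (o : Ordinal.{u}) (G : Set Ordinal.{u} → Set Ordinal.{u})
    {i j : Ordinal.{u}} (hij : i < j) : clubChain o G j ⊆ G (clubChain o G i) := by
  intro x hx
  rw [clubChain] at hx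
  exact mem_iInter.1 hx.2 ⟨i, hij⟩

theorem isClubIn_clubChain {κ : Cardinal.{u}} (hκ : κ.IsRegular) (hκ' : ℵ₀ < κ)
    {G : Set Ordinal.{u} → Set Ordinal.{u}}
    (hG : ∀ E, IsClubIn E κ.ord → IsClubIn (G E) κ.ord) (i : Ordinal.{u}) (hi : i < κ.ord) :
    IsClubIn (clubChain κ.ord G i) κ.ord := by
  induction i using WellFoundedLT.induction with
  | ind i ih =>
    rw [clubChain]
    refine isClubIn_iInter hκ hκ' ?_ fun j => hG _ (ih j.1 j.2 (lt_trans j.2 hi))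
    rw [Cardinal.mk_Iio_ordinal, Cardinal.lift_lt]
    exact Cardinal.lt_ord.1 hi

/-! ### Complete ideals -/

theorem IsCompleteIdealOn.union_mem {κ : Cardinal.{u}} {X : Set Ordinal.{u}}
    {J : Set (Set Ordinal.{u})} (hJ : IsCompleteIdealOn κ X J) (hκ : ℵ₀ ≤ κ)
    {A B : Set Ordinal.{u}} (hA : A ∈ J) (hB : B ∈ J) : A ∪ B ∈ J := by
  have := hJ.iUnion_mem (ULift Bool) (fun b => bif b.down then A else B)
    ((Cardinal.lt_aleph0_of_finite _).trans_le hκ) (by rintro ⟨_ | _⟩ <;> assumption)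
  convert this using 1
  ext x
  simp [or_comm]

theorem mem_bddAccIdeal_of_bdd {C A : Set Ordinal.{u}} (hA : A ⊆ C) {β : Ordinal.{u}} (hβ : β ∈ C)
    (h : ∀ α ∈ A, α < β) : A ∈ bddAccIdeal C :=
  ⟨hA, sdiff_subset.trans hA, β, hβ, fun α hα => h α hα.1⟩

/-- A club meeting `C` in a positive set accumulates at `δ`. -/
theorem mem_acc_of_notMem {κ : Cardinal.{u}} {E C : Set Ordinal.{u}} {J : Set (Set Ordinal.{u})}
    (hE : IsClubIn E κ.ord) {δ : Ordinal.{u}} (hδ : δ < κ.ord) (hC : IsClubIn C δ)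
    (hJ : bddAccIdeal C ⊆ J) (hlim : Order.IsSuccLimit δ) (hpos : E ∩ C ∉ J) : δ ∈ acc E := by
  have hunb : ∀ β < δ, ∃ α ∈ E ∩ Iio δ, β < α := by
    intro β hβ
    by_contra! hno
    obtain ⟨γ, hγ, hle⟩ := hC.exists_ge (Order.succ β) (hlim.succ_lt hβ)
    exact hpos (hJ (mem_bddAccIdeal_of_bdd inter_subset_right hγ fun α hα =>
      (hno α ⟨hα.1, hC.1 hα.2⟩).trans_lt (Order.succ_le_iff.1 hle)))
  have hlub := (isLUB_iff_forall_lt (A := E ∩ Iio δ) inter_subset_right).2 hunb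
  have h0 : 0 < δ := by
    obtain ⟨β, hβ⟩ := not_isMin_iff.1 hlim.not_isMin
    exact (zero_le : 0 ≤ β).trans_lt hβ
  obtain ⟨α, hα, -⟩ := hunb 0 h0
  exact ⟨hE.mem_of_isLUB inter_subset_left ⟨α, hα⟩ hδ hlub, h0.ne', hlub⟩

/-- The ideal of sets with bounded nonaccumulating part is complete below the cofinality. -/
theorem isCompleteIdealOn_bddAccIdeal {κ : Cardinal.{u}} {C : Set Ordinal.{u}} {δ : Ordinal.{u}}
    (hC : IsClubIn C δ) (hδ : δ.cof = κ) : IsCompleteIdealOn κ C (bddAccIdeal C) where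
  subset_carrier A hA := hA.1
  mem_of_subset A hA B hB := by
    obtain ⟨h₁, h₂, β, hβ, h₃⟩ := hA
    exact ⟨hB.trans h₁, (sdiff_subset.trans hB).trans h₁, β, hβ, fun α hα => h₃ α ⟨hB hα.1, hα.2⟩⟩
  iUnion_mem ι f hι hf := by
    choose hsub _ b hb hlt using hf
    have hsup : ⨆ i, b i < δ := Ordinal.iSup_lt_of_lt_cof (by rwa [hδ]) fun i => hC.1 (hb i)
    obtain ⟨β, hβ, hle⟩ := hC.exists_ge _ hsup
    have hU : (⋃ i, f i) ⊆ C := iUnion_subset hsub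
    refine ⟨hU, sdiff_subset.trans hU, β, hβ, fun α hα => ?_⟩
    obtain ⟨i, hi⟩ := mem_iUnion.1 hα.1
    exact (hlt i α ⟨hi, hα.2⟩).trans_le ((Ordinal.le_iSup b i).trans hle)

/-! ### Colourings positive on every club -/

/-- A disjoint family with at least `μ` distinguished members has a colouring with `μ` colours in
which every colour class contains a distinguished member. -/
theorem exists_coloring {μ : Cardinal.{u}} (hμ : 0 < μ) {X : Type (u + 1)}
    (B : X → Set Ordinal.{u}) (hB : ∀ x y α, α ∈ B x → α ∈ B y → x = y) (M : Set X)
    (hM : Cardinal.lift.{u + 1} μ ≤ #M) :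
    ∃ h : Ordinal.{u} → Ordinal.{u}, (∀ α, h α < μ.ord) ∧
      ∀ γ < μ.ord, ∃ x ∈ M, ∀ α ∈ B x, h α = γ := by
  classical
  have : #(Iio μ.ord) ≤ #M := by rwa [Cardinal.mk_Iio_ordinal, card_ord]
  obtain ⟨i⟩ := this
  refine ⟨fun α => if H : ∃ γ : Iio μ.ord, α ∈ B (i γ) then H.choose.1 else 0, fun α => ?_,
    fun γ hγ => ⟨i ⟨γ, hγ⟩, (i ⟨γ, hγ⟩).2, fun α hα => ?_⟩⟩
  · dsimp only
    split_ifs with H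
    · exact H.choose.2
    · exact Cardinal.lt_ord.2 (by simpa using hμ)
  · have H : ∃ γ : Iio μ.ord, α ∈ B (i γ) := ⟨⟨γ, hγ⟩, hα⟩
    have := i.injective (Subtype.ext (hB _ _ _ H.choose_spec hα))
    simp only [dif_pos H, this]

/-- If no colouring has all its colour classes positive on every club, then a disjoint family of
fewer than `lam` sets has fewer than `μ` members positive on some club. -/
theorem exists_club_few_positive {μ lam κ : Cardinal.{u}} (hμ : 0 < μ) (hlam : ℵ₀ ≤ lam)
    (hκ : κ.IsRegular) (hlamκ : lam < κ) {S : Set Ordinal.{u}}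
    {C : Ordinal.{u} → Set Ordinal.{u}} {J : Ordinal.{u} → Set (Set Ordinal.{u})}
    (hJ : ∀ δ ∈ S, IsCompleteIdealOn lam (C δ) (J δ))
    (hno : ∀ h : Ordinal.{u} → Ordinal.{u} → Ordinal.{u}, (∀ δ α, h δ α < μ.ord) →
      ∃ E, IsClubIn E κ.ord ∧ ∀ δ ∈ S, δ ∈ acc E →
        ∃ γ < μ.ord, {α | α ∈ C δ ∧ h δ α = γ ∧ α ∈ E} ∈ J δ)
    {X : Type (u + 1)} (hX : #X < Cardinal.lift.{u + 1} lam)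
    (B : Ordinal.{u} → X → Set Ordinal.{u})
    (hB : ∀ δ ∈ S, ∀ x y α, α ∈ B δ x → α ∈ B δ y → x = y) :
    ∃ E, IsClubIn E κ.ord ∧ ∀ δ ∈ S, δ ∈ acc E →
      #{x | B δ x ∩ (C δ ∩ E) ∉ J δ} < Cardinal.lift.{u + 1} μ := by
  -- The colouring is tailored to `E`: if at least μ pieces are positive on `E`, every colour is
  -- constant on a positive piece, so a null colour class kills a piece.
  have hcol : ∀ (E : Set Ordinal.{u}) (δ : Ordinal.{u}), ∃ h : Ordinal.{u} → Ordinal.{u},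
      (∀ α, h α < μ.ord) ∧ (δ ∈ S →
        Cardinal.lift.{u + 1} μ ≤ #{x | B δ x ∩ (C δ ∩ E) ∉ J δ} →
        ∀ γ < μ.ord, ∃ x, B δ x ∩ (C δ ∩ E) ∉ J δ ∧ ∀ α ∈ B δ x, h α = γ) := by
    intro E δ
    by_cases H : δ ∈ S ∧ Cardinal.lift.{u + 1} μ ≤ #{x | B δ x ∩ (C δ ∩ E) ∉ J δ}
    · obtain ⟨h, h₁, h₂⟩ := exists_coloring hμ (B δ) (hB δ H.1) _ H.2
      exact ⟨h, h₁, fun _ _ => h₂⟩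
    · exact ⟨fun _ => 0, fun _ => Cardinal.lt_ord.2 (by simpa using hμ),
        fun h₁ h₂ => absurd ⟨h₁, h₂⟩ H⟩
  choose h hlt hh using hcol
  choose G hG hbad using fun E => hno (h E) (hlt E)
  have hchain : ∀ i < κ.ord, IsClubIn (clubChain κ.ord G i) κ.ord :=
    isClubIn_clubChain hκ (hlam.trans_lt hlamκ) fun E _ => hG E
  refine ⟨clubChain κ.ord G lam.ord, hchain _ (Cardinal.ord_lt_ord.2 hlamκ), fun δ hδ hacc => ?_⟩
  by_contra! hlarge
  have hmono : ∀ {E E' : Set Ordinal.{u}} {x : X}, E ⊆ E' → B δ x ∩ (C δ ∩ E) ∉ J δ →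
      B δ x ∩ (C δ ∩ E') ∉ J δ := fun hEE' hx hx' =>
    hx ((hJ δ hδ).mem_of_subset _ hx' _
      (inter_subset_inter_right _ (inter_subset_inter_right _ hEE')))
  -- At every stage below λ some piece is positive on the current club and null on the next. These
  -- pieces are distinct, which is too many for `X`.
  have hstep : ∀ i : Iio lam.ord, ∃ x : X,
      B δ x ∩ (C δ ∩ clubChain κ.ord G i.1) ∉ J δ ∧
      B δ x ∩ (C δ ∩ G (clubChain κ.ord G i.1)) ∈ J δ := by
    rintro ⟨i, hi⟩
    obtain ⟨γ, hγ, hγJ⟩ := hbad (clubChain κ.ord G i) δ hδ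
      (acc_mono (clubChain_subset κ.ord G hi) hacc)
    obtain ⟨x, hx, hxh⟩ := hh (clubChain κ.ord G i) δ hδ
      (hlarge.trans (Cardinal.mk_le_mk_of_subset
        fun x hx => hmono (clubChain_anti κ.ord G (le_of_lt hi)) hx)) γ hγ
    exact ⟨x, hx, (hJ δ hδ).mem_of_subset _ hγJ _ fun α hα => ⟨hα.2.1, hxh α hα.1, hα.2.2⟩⟩
  choose x hx hx' using hstep
  have hne : ∀ i j, i < j → x i ≠ x j := fun i j hij heq =>
    hmono (clubChain_subset κ.ord G (show i.1 < j.1 from hij)) (heq ▸ hx j) (hx' i)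
  have hinj : Function.Injective x := fun i j hij => by
    rcases lt_trichotomy i j with hlt | heq | hlt
    · exact absurd hij (hne i j hlt)
    · exact heq
    · exact absurd hij.symm (hne j i hlt)
  have := Cardinal.mk_le_of_injective hinj
  rw [Cardinal.mk_Iio_ordinal, card_ord] at this
  exact absurd hX (not_lt.2 this)

theorem exists_injOn_Iio {μ : Cardinal.{u}} {α : Ordinal.{u}} (hα : α.card ≤ μ) :
    ∃ f : Ordinal.{u} → Ordinal.{u}, MapsTo f (Iio α) (Iio μ.ord) ∧ InjOn f (Iio α) := by
  have : #(Iio α) ≤ #(Iio μ.ord) := by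
    rw [Cardinal.mk_Iio_ordinal, Cardinal.mk_Iio_ordinal, card_ord]
    exact Cardinal.lift_le.2 hα
  obtain ⟨i⟩ := this
  classical
  refine ⟨fun ξ => if H : ξ < α then (i ⟨ξ, H⟩).1 else 0, fun ξ hξ => ?_, fun ξ hξ ξ' hξ' heq => ?_⟩
  · simp only [dif_pos (show ξ < α from hξ)]
    exact (i ⟨ξ, hξ⟩).2
  · simp only [dif_pos (show ξ < α from hξ), dif_pos (show ξ' < α from hξ')] at heq
    exact congrArg Subtype.val (i.injective (Subtype.ext heq))

/-- A map from `μ⁺` to `μ` is constant on a bounded set of size `μ`. -/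
theorem exists_large_bounded_fiber {μ lam : Cardinal.{u}} (hμ : ℵ₀ ≤ μ) (hlam : lam = Order.succ μ)
    (z : Iio lam.ord → Iio μ.ord) :
    ∃ ζ : Iio μ.ord, ∃ η : Iio lam.ord, Cardinal.lift.{u + 1} μ ≤
      #{x : Iio η.1 | z (inclusion (Iio_subset_Iio (mem_Iio.1 η.2).le) x) = ζ} := by
  have hreg : lam.IsRegular := hlam ▸ isRegular_succ hμ
  have hμlam : μ < lam := hlam ▸ Order.lt_succ μ
  have hL : #(Iio lam.ord) = Cardinal.lift.{u + 1} lam := by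
    rw [Cardinal.mk_Iio_ordinal, card_ord]
  obtain ⟨ζ, hζ⟩ := Cardinal.infinite_pigeonhole z
    (by rw [hL]; simpa using hreg.aleph0_le)
    (by rw [hL, hreg.lift.cof_ord, Cardinal.mk_Iio_ordinal, card_ord]; simpa using hμlam)
  have hle : Cardinal.lift.{u + 1} μ ≤ #(z ⁻¹' {ζ}) := by
    rw [hζ, hL]; simpa using hμlam.le
  -- A subset of size exactly μ of the large fibre is bounded, by regularity of λ; successors make
  -- the bound strict.
  obtain ⟨p, hp, hpc⟩ := Cardinal.le_mk_iff_exists_subset.1 hle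
  have hsup : sSup ((fun x : Iio lam.ord => Order.succ x.1) '' p) < lam.ord := by
    refine Ordinal.sSup_lt_of_lt_cof ?_ ?_
    · rw [← Ordinal.lift_cof, hreg.cof_ord]
      refine Cardinal.mk_image_le.trans_lt ?_
      rw [hpc]
      simpa using hμlam
    · rintro _ ⟨x, -, rfl⟩
      exact (Cardinal.isSuccLimit_ord hreg.aleph0_le).succ_lt x.2
  refine ⟨ζ, ⟨_, hsup⟩, ?_⟩
  have hlt : ∀ x : p, x.1.1 < sSup ((fun x : Iio lam.ord => Order.succ x.1) '' p) := fun x => by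
    refine Order.succ_le_iff.1 (le_csSup ⟨lam.ord, ?_⟩ ⟨x.1, x.2, rfl⟩)
    rintro _ ⟨y, -, rfl⟩
    exact Order.succ_le_of_lt y.2
  rw [← hpc]
  refine Cardinal.mk_le_of_injective (f := fun x : p => ⟨⟨x.1.1, hlt x⟩, hp x.2⟩) fun x y hxy => ?_
  exact Subtype.ext (Subtype.ext (congrArg (fun w => w.1.1) hxy))

/-- Positivity on every club at some point upgrades to a colouring with all its colour classes
positive on every club, at some point. -/
theorem exists_coloring_positive {μ lam : Cardinal.{u}} (hμ : ℵ₀ ≤ μ) (hlam : lam = Order.succ μ)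
    {S : Set Ordinal.{u}} (hScof : ∀ δ ∈ S, δ.cof = lam)
    (hSlt : S ⊆ Iio (Order.succ lam).ord)
    {C : Ordinal.{u} → Set Ordinal.{u}} {J : Ordinal.{u} → Set (Set Ordinal.{u})}
    (hC : IsStrictClubSystem S C)
    (hJ : ∀ δ ∈ S, IsCompleteIdealOn lam (C δ) (J δ))
    (hbdd : ∀ δ ∈ S, bddAccIdeal (C δ) ⊆ J δ)
    (hpos : ∀ E, IsClubIn E (Order.succ lam).ord → ∃ δ ∈ S, E ∩ C δ ∉ J δ) :
    ∃ h : Ordinal.{u} → Ordinal.{u} → Ordinal.{u}, (∀ δ α, h δ α < μ.ord) ∧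
      ∀ E, IsClubIn E (Order.succ lam).ord → ∃ δ ∈ S, δ ∈ acc E ∧
        ∀ γ < μ.ord, {α | α ∈ C δ ∧ h δ α = γ ∧ α ∈ E} ∉ J δ := by
  have hreg : lam.IsRegular := hlam ▸ isRegular_succ hμ
  have hκ : (Order.succ lam).IsRegular := isRegular_succ hreg.aleph0_le
  have hlamκ : lam < Order.succ lam := Order.lt_succ lam
  have hμlam : μ < lam := hlam ▸ Order.lt_succ μ
  have hlim := Cardinal.isSuccLimit_ord hreg.aleph0_le
  by_contra! hno
  have henum : ∀ δ, ∃ c : Iio lam.ord → Ordinal.{u}, δ ∈ S → StrictMono c ∧ range c = C δ := by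
    intro δ
    by_cases hδ : δ ∈ S
    · obtain ⟨i⟩ := (hC δ hδ).2
      rw [hScof δ hδ] at i
      refine ⟨fun x => (i x).1, fun _ => ⟨fun x y hxy => i.strictMono hxy, ?_⟩⟩
      ext y
      exact ⟨fun ⟨x, hx⟩ => hx ▸ (i x).2, fun hy => ⟨i.symm ⟨y, hy⟩, by simp⟩⟩
    · exact ⟨fun _ => 0, fun h => absurd h hδ⟩
  choose c hc using henum
  choose f hf using fun α : Iio lam.ord => exists_injOn_Iio (μ := μ) (α := α.1)
    (Order.lt_succ_iff.1 (hlam ▸ Cardinal.lt_ord.1 α.2))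
  -- The Ulam matrix. Injectivity of each `f α` makes a row disjoint; the entries of column `ξ`
  -- cover all points of index above `ξ`.
  let B : Iio μ.ord → Ordinal.{u} → Iio lam.ord → Set Ordinal.{u} := fun ζ δ ξ =>
    {y | ∃ α : Iio lam.ord, ξ < α ∧ f α ξ.1 = ζ.1 ∧ c δ α = y}
  -- Rows are cut at a bound below λ because the family must have fewer than λ members.
  have hfew := fun p : Iio μ.ord × Iio lam.ord =>
    exists_club_few_positive (Cardinal.aleph0_pos.trans_le hμ) hreg.aleph0_le hκ hlamκ hJ hno
      (X := Iio p.2.1)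
      (by rw [Cardinal.mk_Iio_ordinal, Cardinal.lift_lt]; exact Cardinal.lt_ord.1 p.2.2)
      (fun δ ξ => B p.1 δ (inclusion (Iio_subset_Iio (mem_Iio.1 p.2.2).le) ξ)) (by
        rintro δ hδ x y _ ⟨α, hα, hα', rfl⟩ ⟨α', hx, hx', heq⟩
        obtain rfl := (hc δ hδ).1.injective heq
        exact Subtype.ext ((hf α').2 hα hx (hα'.trans hx'.symm)))
  choose E hE hEfew using hfew
  have hclub := isClubIn_iInter hκ (hreg.aleph0_le.trans_lt hlamκ) (by
    rw [Cardinal.mk_prod, Cardinal.mk_Iio_ordinal, Cardinal.mk_Iio_ordinal, card_ord, card_ord,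
      Cardinal.lift_id, Cardinal.lift_id, ← Cardinal.lift_mul, Cardinal.lift_lt]
    exact (Cardinal.mul_le_max_of_aleph0_le_left hμ).trans_lt (by simp [hμlam.le, hlamκ])) hE
  obtain ⟨δ, hδ, hδpos⟩ := hpos _ hclub
  have hδlim : Order.IsSuccLimit δ := by
    rw [← Ordinal.one_lt_cof_iff, hScof δ hδ]
    exact Cardinal.one_lt_aleph0.trans_le hreg.aleph0_le
  have hδacc := mem_acc_of_notMem hclub (hSlt hδ) (hC δ hδ).1 (hbdd δ hδ) hδlim hδpos
  set D : Set Ordinal.{u} := Iio (Order.succ lam).ord ∩ ⋂ i, E i with hD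
  -- Otherwise `C δ ∩ D` would be the union of μ null sets and a bounded set.
  have hz : ∀ ξ : Iio lam.ord, ∃ ζ : Iio μ.ord, B ζ δ ξ ∩ (C δ ∩ D) ∉ J δ := by
    intro ξ
    by_contra! hall
    have h₁ := (hJ δ hδ).iUnion_mem μ.ord.ToType
      (fun i => B (Ordinal.ToType.mk.symm i) δ ξ ∩ (C δ ∩ D)) (by simpa using hμlam)
      fun i => hall _
    have h₂ : {y | y ∈ C δ ∧ ∃ α ≤ ξ, c δ α = y} ∈ J δ := by
      refine hbdd δ hδ (mem_bddAccIdeal_of_bdd (fun _ h => h.1)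
        (β := c δ ⟨Order.succ ξ.1, hlim.succ_lt ξ.2⟩) ?_ ?_)
      · rw [← (hc δ hδ).2]; exact mem_range_self _
      · rintro _ ⟨-, α, hα, rfl⟩
        exact (hc δ hδ).1 (Order.lt_succ_of_le (show α.1 ≤ ξ.1 from hα))
    refine hδpos ((hJ δ hδ).mem_of_subset _
      ((hJ δ hδ).union_mem hreg.aleph0_le h₁ h₂) _ fun y hy => ?_)
    obtain ⟨α, rfl⟩ : y ∈ range (c δ) := by rw [(hc δ hδ).2]; exact hy.2
    rcases lt_or_ge ξ α with hlt | hle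
    · refine Or.inl (mem_iUnion.2 ⟨Ordinal.ToType.mk ⟨f α ξ.1, (hf α).1 hlt⟩, ?_, hy.2, hy.1⟩)
      exact ⟨α, hlt, by simp, rfl⟩
    · exact Or.inr ⟨hy.2, α, hle, rfl⟩
  choose z hz using hz
  obtain ⟨ζ, η, hlarge⟩ := exists_large_bounded_fiber hμ hlam z
  have hDE : D ⊆ E (ζ, η) := fun x hx => mem_iInter.1 hx.2 _
  refine absurd (hEfew (ζ, η) δ hδ (acc_mono hDE hδacc)) (not_lt.2 (hlarge.trans
    (Cardinal.mk_le_mk_of_subset fun ξ hξ hmem => ?_)))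
  have hξ' : z (inclusion (Iio_subset_Iio (mem_Iio.1 η.2).le) ξ) = ζ := hξ
  refine hz (inclusion (Iio_subset_Iio (mem_Iio.1 η.2).le) ξ) ((hJ δ hδ).mem_of_subset _ hmem _ ?_)
  rw [hξ']
  exact inter_subset_inter_right _ (inter_subset_inter_right _ hDE)

/-- The points at which a colouring works on a given club form a stationary set. -/
theorem isStationaryIn_coloring_positive {μ lam κ : Cardinal.{u}} (hκ : κ.IsRegular) (hκ' : ℵ₀ < κ)
    {S : Set Ordinal.{u}} (hSlt : S ⊆ Iio κ.ord)
    {C : Ordinal.{u} → Set Ordinal.{u}} {J : Ordinal.{u} → Set (Set Ordinal.{u})}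
    (hJ : ∀ δ ∈ S, IsCompleteIdealOn lam (C δ) (J δ))
    {h : Ordinal.{u} → Ordinal.{u} → Ordinal.{u}}
    (hh : ∀ E, IsClubIn E κ.ord → ∃ δ ∈ S, δ ∈ acc E ∧
        ∀ γ < μ.ord, {α | α ∈ C δ ∧ h δ α = γ ∧ α ∈ E} ∉ J δ)
    {E : Set Ordinal.{u}} (hE : IsClubIn E κ.ord) :
    IsStationaryIn {δ | δ ∈ S ∧ δ ∈ acc E ∧
      ∀ γ < μ.ord, {α | α ∈ C δ ∧ h δ α = γ ∧ α ∈ E} ∉ J δ} κ.ord := by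
  refine isStationaryIn_iff.2 ⟨fun δ hδ => hSlt hδ.1, fun E' hE' => ?_⟩
  -- One good point for the intersection suffices: it is good for `E` and, since `acc` consists of
  -- members, lies in `E'`.
  obtain ⟨δ, hδ, hacc, hγ⟩ := hh _ (hE.inter hκ hκ' hE')
  refine ⟨δ, ⟨hδ, acc_mono inter_subset_left hacc, fun γ hlt hmem => hγ γ hlt ?_⟩, hacc.1.2⟩
  exact (hJ δ hδ).mem_of_subset _ hmem _ fun α hα => ⟨hα.1, hα.2.1, hα.2.2.1⟩

/-! ### Descending along ladders projected to a club -/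

/-- `γ` is reached from `α` by projecting to `E` and, as long as the projection has cofinality
below `lam`, stepping down to a member of its ladder `e`. -/
inductive Reach (lam : Cardinal.{u}) (e : Ordinal.{u} → Set Ordinal.{u}) (E : Set Ordinal.{u}) :
    Ordinal.{u} → Ordinal.{u} → Prop
  | proj (α : Ordinal.{u}) : Reach lam e E α (sSup (E ∩ Iic α))
  | step {α α' γ : Ordinal.{u}} : (sSup (E ∩ Iic α)).cof < lam → α' ∈ e (sSup (E ∩ Iic α)) →
      Reach lam e E α' γ → Reach lam e E α γ

/-- `e` assigns to each ordinal of cofinality below `lam` a cofinal subset with fewer than `lam`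
elements. -/
def IsLadderSystem (lam : Cardinal.{u}) (e : Ordinal.{u} → Set Ordinal.{u}) : Prop :=
  ∀ β, β.cof < lam → e β ⊆ Iio β ∧ (∀ ε < β, ∃ α ∈ e β, ε ≤ α) ∧
    #(e β) < Cardinal.lift.{u + 1} lam

theorem exists_isLadderSystem (lam : Cardinal.{u}) : ∃ e, IsLadderSystem lam e := by
  have : ∀ β : Ordinal.{u}, ∃ s : Set Ordinal.{u}, s ⊆ Iio β ∧ (∀ ε < β, ∃ α ∈ s, ε ≤ α) ∧
      #s = Cardinal.lift.{u + 1} β.cof := by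
    intro β
    obtain ⟨s, hs, hcard⟩ := Order.exists_cof_eq (Iio β)
    refine ⟨Subtype.val '' s, ?_, fun ε hε => ?_, ?_⟩
    · rintro _ ⟨x, -, rfl⟩; exact x.2
    · obtain ⟨y, hy, hle⟩ := hs ⟨ε, hε⟩
      exact ⟨y, ⟨y, hy, rfl⟩, hle⟩
    · rw [Cardinal.mk_image_eq Subtype.val_injective, hcard, Ordinal.cof_Iio, Ordinal.lift_cof]
  choose e he using this
  refine ⟨e, fun β hβ => ⟨(he β).1, (he β).2.1, ?_⟩⟩
  rw [(he β).2.2]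
  exact Cardinal.lift_lt.2 hβ

theorem sSup_inter_Iic_le (E : Set Ordinal.{u}) (α : Ordinal.{u}) : sSup (E ∩ Iic α) ≤ α :=
  csSup_le' fun _ h => h.2

theorem le_sSup_inter_Iic {E : Set Ordinal.{u}} {ε α : Ordinal.{u}} (hε : ε ∈ E) (hle : ε ≤ α) :
    ε ≤ sSup (E ∩ Iic α) :=
  le_csSup ⟨α, fun _ h => h.2⟩ ⟨hε, hle⟩

theorem Reach.le {lam : Cardinal.{u}} {e : Ordinal.{u} → Set Ordinal.{u}}
    (he : IsLadderSystem lam e) {E : Set Ordinal.{u}} {α γ : Ordinal.{u}} (h : Reach lam e E α γ) :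
    γ ≤ α := by
  induction h with
  | proj α => exact sSup_inter_Iic_le E α
  | step hcof hmem _ ih =>
    exact ih.trans (le_of_lt (lt_of_lt_of_le ((he _ hcof).1 hmem) (sSup_inter_Iic_le E _)))

/-- Each step strictly decreases the starting point and branches fewer than λ times, so induction
and regularity give the bound. -/
theorem mk_reach_lt {lam : Cardinal.{u}} (hlam : lam.IsRegular)
    {e : Ordinal.{u} → Set Ordinal.{u}} (he : IsLadderSystem lam e) (E : Set Ordinal.{u})
    (α : Ordinal.{u}) : #{γ | Reach lam e E α γ} < Cardinal.lift.{u + 1} lam := by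
  have hL : (Cardinal.lift.{u + 1} lam).IsRegular := hlam.lift
  induction α using WellFoundedLT.induction with
  | ind α ih =>
    set β := sSup (E ∩ Iic α) with hβ
    have hsingle : #({β} : Set Ordinal.{u}) < Cardinal.lift.{u + 1} lam := by
      rw [Cardinal.mk_singleton]
      exact Cardinal.one_lt_aleph0.trans_le hL.aleph0_le
    by_cases hcof : β.cof < lam
    · have hU : #(⋃ α' ∈ e β, {γ | Reach lam e E α' γ} : Set Ordinal.{u}) <
          Cardinal.lift.{u + 1} lam :=
        (Cardinal.card_biUnion_lt_iff_forall_of_isRegular hL (he β hcof).2.2).2 fun α' hα' =>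
          ih α' (lt_of_lt_of_le ((he β hcof).1 hα') (sSup_inter_Iic_le E α))
      refine lt_of_le_of_lt ((Cardinal.mk_le_mk_of_subset (t := {β} ∪ ⋃ α' ∈ e β,
        {γ | Reach lam e E α' γ}) ?_).trans (Cardinal.mk_union_le _ _))
        (Cardinal.add_lt_of_lt hL.aleph0_le hsingle hU)
      rintro γ hγ
      cases hγ with
      | proj => exact Or.inl rfl
      | step _ hmem hr => exact Or.inr (mem_biUnion hmem hr)
    · refine lt_of_le_of_lt (Cardinal.mk_le_mk_of_subset ?_) hsingle
      rintro γ hγ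
      cases hγ with
      | proj => exact rfl
      | step h => exact absurd h hcof

/-- Along a decreasing sequence of clubs of `lam⁺`, descending from `α` eventually reaches a point
of cofinality `lam` lying in all the clubs and above a given common point of cofinality `lam`. -/
theorem exists_reach_of_antitone {lam : Cardinal.{u}}
    {e : Ordinal.{u} → Set Ordinal.{u}}
    (he : IsLadderSystem lam e) {E : Ordinal.{u} → Set Ordinal.{u}} (hanti : Antitone E)
    (hE : ∀ n < ω, IsClubIn (E n) (Order.succ lam).ord) {ε : Ordinal.{u}} (hε : ∀ n < ω, ε ∈ E n)
    (hεcof : ε.cof = lam) (α : Ordinal.{u}) (hα : α < (Order.succ lam).ord) (hle : ε ≤ α) :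
    ∃ γ, ε ≤ γ ∧ γ.cof = lam ∧ ∃ n₀ < ω, ∀ n < ω, n₀ ≤ n → γ ∈ E n ∧ Reach lam e (E n) α γ := by
  induction α using WellFoundedLT.induction with
  | ind α ih =>
    -- The projections of `α` decrease with `n`; from the index of the least one on they are
    -- constant, so the limit value lies in all the clubs.
    obtain ⟨n₁, hn₁, hmin⟩ := (wellFounded_lt (α := Ordinal.{u})).has_min
      {β | ∃ n < ω, sSup (E n ∩ Iic α) = β} ⟨_, 0, omega0_pos, rfl⟩
    obtain ⟨n₁, hn₁ω, rfl⟩ := hn₁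
    have hconst : ∀ n < ω, n₁ ≤ n → sSup (E n ∩ Iic α) = sSup (E n₁ ∩ Iic α) := fun n hn hle =>
      le_antisymm (csSup_le_csSup ⟨α, fun _ h => h.2⟩ ⟨ε, hε n hn, ‹ε ≤ α›⟩
        (inter_subset_inter_left _ (hanti hle))) (not_lt.1 (hmin _ ⟨n, hn, rfl⟩))
    have hβα := sSup_inter_Iic_le (E n₁) α
    have hεβ := le_sSup_inter_Iic (hε n₁ hn₁ω) hle
    have hmem : ∀ n < ω, n₁ ≤ n → sSup (E n₁ ∩ Iic α) ∈ E n := fun n hn hn₁n => by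
      rw [← hconst n hn hn₁n]
      exact (hE n hn).mem_of_isLUB inter_subset_left ⟨ε, hε n hn, hle⟩
        ((sSup_inter_Iic_le (E n) α).trans_lt hα)
        (isLUB_csSup ⟨ε, hε n hn, hle⟩ ⟨α, fun _ h => h.2⟩)
    set β := sSup (E n₁ ∩ Iic α) with hβ
    have hβcof : β.cof ≤ lam :=
      (Ordinal.cof_le_card β).trans (Order.lt_succ_iff.1 (Cardinal.lt_ord.1 (hβα.trans_lt hα)))
    rcases hβcof.lt_or_eq with hlt | heq
    -- Differing cofinalities separate `ε` from `β`, so the ladder of `β` has a point in between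
    -- from which to continue.
    · have hεβ' : ε < β := hεβ.lt_of_ne (by rintro h; rw [← h] at hlt; exact hlt.ne hεcof)
      obtain ⟨α', hα', hεα'⟩ := (he β hlt).2.1 ε hεβ'
      have hα'α : α' < α := lt_of_lt_of_le ((he β hlt).1 hα') hβα
      obtain ⟨γ, h₁, h₂, n₀, hn₀, h₃⟩ := ih α' hα'α (hα'α.trans hα) hεα'
      refine ⟨γ, h₁, h₂, max n₀ n₁, max_lt hn₀ hn₁ω, fun n hn hle' => ?_⟩
      obtain ⟨h₄, h₅⟩ := h₃ n hn (le_of_max_le_left hle')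
      have := hconst n hn (le_of_max_le_right hle')
      exact ⟨h₄, Reach.step (by rwa [this]) (by rwa [this]) h₅⟩
    · refine ⟨β, hεβ, heq, n₁, hn₁ω, fun n hn hle' => ⟨hmem n hn hle', ?_⟩⟩
      rw [← hconst n hn hle']
      exact Reach.proj α

/-! ### Guessing clubs by small cofinal sets -/

/-- `A` is a cofinal subset of `δ` all whose proper initial segments have fewer than `lam`
elements. -/
structure IsThinCofinal (lam : Cardinal.{u}) (A : Set Ordinal.{u}) (δ : Ordinal.{u}) : Prop where
  subset : A ⊆ Iio δ
  exists_ge : ∀ β < δ, ∃ α ∈ A, β ≤ α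
  mk_lt : ∀ β < δ, #(A ∩ Iio β : Set Ordinal.{u}) < Cardinal.lift.{u + 1} lam

theorem exists_isThinCofinal (δ : Ordinal.{u}) : ∃ A, IsThinCofinal δ.cof A δ := by
  obtain ⟨s, hs, htype⟩ := Ordinal.exists_ord_cof_eq (Iio δ)
  refine ⟨Subtype.val '' s, ?_, fun ε hε => ?_, fun β hβ => ?_⟩
  · rintro _ ⟨x, -, rfl⟩; exact x.2
  · obtain ⟨y, hy, hle⟩ := hs ⟨ε, hε⟩
    exact ⟨y, ⟨y, hy, rfl⟩, hle⟩
  · rw [Ordinal.cof_Iio, ← Ordinal.lift_cof] at htype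
    obtain ⟨y, hy, hle⟩ := hs ⟨β, hβ⟩
    have hlt := Ordinal.typein_lt_type (α := s) (· < ·) ⟨y, hy⟩
    rw [htype, Cardinal.lt_ord, Ordinal.card_typein] at hlt
    refine lt_of_le_of_lt ?_ hlt
    have hsub : ∀ x : (Subtype.val '' s ∩ Iio β : Set Ordinal.{u}),
        ∃ x' : {z : s // z < ⟨y, hy⟩}, x'.1.1.1 = x.1 := by
      rintro ⟨_, ⟨x, hx, rfl⟩, hxβ⟩
      exact ⟨⟨⟨x, hx⟩, show x < y from lt_of_lt_of_le hxβ hle⟩, rfl⟩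
    choose g hg using hsub
    exact Cardinal.mk_le_of_injective (f := g) fun a b hab =>
      Subtype.ext ((hg a).symm.trans ((congrArg (fun w => w.1.1.1) hab).trans (hg b)))

theorem IsThinCofinal.exists_isLeast {lam : Cardinal.{u}} {c : Set Ordinal.{u}} {δ : Ordinal.{u}}
    (hc : IsThinCofinal lam c δ) {ε : Ordinal.{u}} (hε : ε < δ) :
    ∃ α ∈ c, ε ≤ α ∧ ∀ x ∈ c, x < α → x < ε := by
  obtain ⟨α, hα, hle⟩ := hc.exists_ge ε hε
  obtain ⟨m, hm, hmin⟩ := (wellFounded_lt (α := Ordinal.{u})).has_min {x | x ∈ c ∧ ε ≤ x}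
    ⟨α, hα, hle⟩
  exact ⟨m, hm.1, hm.2, fun x hx hlt => not_le.1 fun h => hmin x ⟨hx, h⟩ hlt⟩

/-- The points of cofinality `lam` below `δ` reached from members of `c`, each above the preceding
members of `c`. -/
def reachable (lam : Cardinal.{u}) (e : Ordinal.{u} → Set Ordinal.{u}) (c E : Set Ordinal.{u}) :
    Set Ordinal.{u} :=
  {γ | γ.cof = lam ∧ ∃ α ∈ c, (∀ x ∈ c, x < α → x ≤ γ) ∧ Reach lam e E α γ}

/-- The requirement that `γ` be above the earlier members of `c` ensures that only starts in a
proper initial segment of `c` contribute below `β`. -/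
theorem mk_reachable_lt {lam : Cardinal.{u}} (hlam : lam.IsRegular)
    {e : Ordinal.{u} → Set Ordinal.{u}} (he : IsLadderSystem lam e) {c : Set Ordinal.{u}}
    {δ : Ordinal.{u}} (hδ : Order.IsSuccLimit δ) (hc : IsThinCofinal lam c δ) (E : Set Ordinal.{u})
    {β : Ordinal.{u}} (hβ : β < δ) :
    #(reachable lam e c E ∩ Iio β : Set Ordinal.{u}) < Cardinal.lift.{u + 1} lam := by
  obtain ⟨β', hβ', hle⟩ := hc.exists_ge β hβ
  have hlt := hc.mk_lt _ (hδ.succ_lt (hc.subset hβ'))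
  refine lt_of_le_of_lt (Cardinal.mk_le_mk_of_subset
    (t := ⋃ α ∈ c ∩ Iio (Order.succ β'), {γ | Reach lam e E α γ}) ?_)
    ((Cardinal.card_biUnion_lt_iff_forall_of_isRegular hlam.lift hlt).2
      fun α _ => mk_reach_lt hlam he E α)
  rintro γ ⟨⟨-, α, hα, hge, hr⟩, hγβ⟩
  refine mem_biUnion ⟨hα, mem_Iio.2 (Order.lt_succ_of_le (not_lt.1 fun h => ?_))⟩ hr
  exact absurd (hge β' hβ' h) (not_le.2 (lt_of_lt_of_le hγβ hle))

theorem reachable_subset {lam : Cardinal.{u}} {e : Ordinal.{u} → Set Ordinal.{u}}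
    (he : IsLadderSystem lam e) {c : Set Ordinal.{u}} {δ : Ordinal.{u}} (hc : c ⊆ Iio δ)
    (E : Set Ordinal.{u}) : reachable lam e c E ⊆ Iio δ := by
  rintro γ ⟨-, α, hα, -, hr⟩
  exact (hr.le he).trans_lt (hc hα)

/-- Some club `E` makes the reachable sets guess every club. -/
theorem exists_club_reachable_guessing {lam : Cardinal.{u}} (hlam : lam.IsRegular)
    (hlam' : ℵ₀ < lam) {S : Set Ordinal.{u}} (hScof : ∀ δ ∈ S, δ.cof = lam)
    (hS : IsStationaryIn S (Order.succ lam).ord) {e : Ordinal.{u} → Set Ordinal.{u}}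
    (he : IsLadderSystem lam e) {c : Ordinal.{u} → Set Ordinal.{u}}
    (hc : ∀ δ ∈ S, IsThinCofinal lam (c δ) δ) :
    ∃ E, ∀ E', IsClubIn E' (Order.succ lam).ord →
      ∃ δ ∈ S, ∀ β < δ, ∃ γ ∈ reachable lam e (c δ) E ∩ E', β < γ := by
  have hκ : (Order.succ lam).IsRegular := isRegular_succ hlam.aleph0_le
  have hκ' : ℵ₀ < Order.succ lam := hlam'.trans (Order.lt_succ lam)
  by_contra! hno
  choose G hG hbad using hno
  have hωκ : ω < (Order.succ lam).ord := by
    rw [Cardinal.lt_ord, card_omega0]; exact hκ'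
  have hchain := isClubIn_clubChain hκ hκ' fun E _ => hG E
  set F := clubChain (Order.succ lam).ord G with hF
  have hanti : Antitone F := clubChain_anti _ _
  -- Limits of `S ∩ F ω` provide points `ε` below `δ` of cofinality λ common to all `F n`, above the
  -- countably many bounds `b n`.
  obtain ⟨δ, hδ, -, hδlim⟩ := hS.exists_mem (isClubIn_limits hκ hκ' (X := S ∩ F ω)
    fun β hβ => by
      have hβ' := (Cardinal.isSuccLimit_ord hκ.aleph0_le).succ_lt hβ
      obtain ⟨α, hα, hα'⟩ := hS.exists_mem ((hchain ω hωκ).inter hκ hκ' (isClubIn_Ico hβ'))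
      exact ⟨α, ⟨hα, hα'.1⟩, Order.succ_le_iff.1 hα'.2.1, hα'.2.2⟩)
  have hb : ∀ n : ℕ, ∃ b < δ, ∀ γ ∈ reachable lam e (c δ) (F n) ∩ G (F n), γ ≤ b :=
    fun n => hbad (F n) δ hδ
  choose b hbδ hb using hb
  have hsup : ⨆ n : ULift.{u} ℕ, b n.down < δ :=
    Ordinal.iSup_lt_of_lt_cof (by rw [hScof δ hδ]; simpa using hlam') fun n => hbδ n.down
  obtain ⟨ε, ⟨hεS, hεF⟩, hbε, hεδ⟩ := hδlim _ hsup
  obtain ⟨α, hα, hεα, hleast⟩ := (hc δ hδ).exists_isLeast hεδ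
  obtain ⟨γ, hεγ, hγcof, n₀, hn₀, hγ⟩ := exists_reach_of_antitone he hanti
    (fun n hn => hchain n (hn.trans hωκ)) (fun n hn => hanti hn.le hεF) (hScof ε hεS) α
    (lt_trans ((hc δ hδ).subset hα) (hS.1 hδ)) hεα
  obtain ⟨n, rfl⟩ := lt_omega0.1 hn₀
  have hsucc : ((n + 1 : ℕ) : Ordinal.{u}) < ω := natCast_lt_omega0 _
  have hnn : (n : Ordinal.{u}) < ((n + 1 : ℕ) : Ordinal.{u}) := by exact_mod_cast n.lt_succ_self
  -- Two consecutive indices are used: `γ` is reached through `F n`, and its membership in the next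
  -- club puts it in `G (F n)`.
  have h₁ := hb n γ ⟨⟨hγcof, α, hα, fun x hx hlt => (hleast x hx hlt).le.trans hεγ,
    (hγ n hn₀ le_rfl).2⟩, clubChain_subset _ G hnn (hγ _ hsucc hnn.le).1⟩
  have h₂ := Ordinal.le_iSup (fun n : ULift.{u} ℕ => b n.down) ⟨n⟩
  exact absurd (hεγ.trans (h₁.trans h₂)) (not_le.2 hbε)

/-! ### Strict clubs from thin cofinal sets -/

/-- Small initial segments bound the order type by λ from above, and cofinality bounds it from
below. -/
theorem IsThinCofinal.nonempty_orderIso {lam : Cardinal.{u}} {C : Set Ordinal.{u}}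
    {δ : Ordinal.{u}} (hC : IsThinCofinal lam C δ) (hδ : δ.cof = lam) :
    Nonempty (Iio lam.ord ≃o C) := by
  have htype : typeLT C = typeLT (Iio lam.ord) := by
    rw [Ordinal.type_lt_Iio, Cardinal.lift_ord]
    refine le_antisymm (le_of_forall_lt fun a ha => ?_) (Cardinal.ord_le.2 ?_)
    · obtain ⟨x, rfl⟩ := Ordinal.typein_surj (α := C) (· < ·) ha
      rw [Cardinal.lt_ord, Ordinal.card_typein]
      refine lt_of_le_of_lt ?_ (hC.mk_lt x.1 (hC.subset x.2))
      exact Cardinal.mk_le_of_injective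
        (f := fun y : {y : C // y < x} => (⟨y.1.1, y.1.2, y.2⟩ : (C ∩ Iio x.1 : Set _)))
        fun a b hab => Subtype.ext (Subtype.ext (congrArg (fun w => w.1) hab))
    · rw [Ordinal.card_type, ← hδ, Ordinal.lift_cof, ← Ordinal.cof_Iio]
      refine (Order.cof_le (s := (Subtype.val ⁻¹' C : Set (Iio δ))) fun x => ?_).trans
        (Cardinal.mk_preimage_of_injective _ _ Subtype.val_injective)
      obtain ⟨y, hy, hle⟩ := hC.exists_ge x.1 x.2
      exact ⟨⟨y, hC.subset hy⟩, hy, hle⟩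
  obtain ⟨r⟩ := Ordinal.type_eq.1 htype
  exact ⟨(OrderIso.ofRelIsoLT r).symm⟩

/-- The closure of `A` in `δ`. -/
def closureIn (A : Set Ordinal.{u}) (δ : Ordinal.{u}) : Set Ordinal.{u} :=
  {β | β < δ ∧ (β ∈ A ∨ β ≠ 0 ∧ IsLUB (A ∩ Iio β) β)}

theorem subset_closureIn {A : Set Ordinal.{u}} {δ : Ordinal.{u}} (hA : A ⊆ Iio δ) :
    A ⊆ closureIn A δ := fun _ hx => ⟨hA hx, Or.inl hx⟩

theorem nacc_closureIn_subset {A : Set Ordinal.{u}} {δ : Ordinal.{u}} (hA : A ⊆ Iio δ) :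
    nacc (closureIn A δ) ⊆ A := by
  rintro β ⟨hβ, hnacc⟩
  rcases hβ.2 with h | ⟨h₀, h⟩
  · exact h
  · exact absurd ⟨hβ, h₀, fun _ hx => hx.2.le,
      fun b hb => h.2 fun _ hx => hb ⟨subset_closureIn hA hx.1, hx.2⟩⟩ hnacc

/-- Between two points of the closure there is a point of the original set. -/
theorem exists_mem_of_lt_closureIn {A : Set Ordinal.{u}} {δ x y : Ordinal.{u}} (hxy : x < y)
    (hy : y ∈ closureIn A δ) : ∃ z ∈ A, x < z ∧ z ≤ y := by
  rcases hy.2 with h | ⟨-, h⟩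
  · exact ⟨y, h, hxy, le_rfl⟩
  · obtain ⟨z, hz, hlt⟩ := (lt_isLUB_iff h).1 hxy
    exact ⟨z, hz.1, hlt, hz.2.le⟩

theorem isClubIn_closureIn {A : Set Ordinal.{u}} {δ : Ordinal.{u}} (hA : A ⊆ Iio δ)
    (hcof : ∀ β < δ, ∃ α ∈ A, β ≤ α) : IsClubIn (closureIn A δ) δ := by
  refine isClubIn_iff.2 ⟨fun _ h => h.1, fun β hβ => ?_, fun t ht hne β hβ hlub => ?_⟩
  · obtain ⟨α, hα, hle⟩ := hcof β hβ
    exact ⟨α, subset_closureIn hA hα, hle⟩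
  · by_cases hβt : β ∈ t
    · exact ht hβt
    refine ⟨hβ, Or.inr ⟨?_, ?_⟩⟩
    · rintro rfl
      obtain ⟨x, hx⟩ := hne
      have : x = 0 := nonpos_iff_eq_zero.1 (hlub.1 hx)
      exact hβt (this ▸ hx)
    · refine (isLUB_iff_forall_lt inter_subset_right).2 fun b hb => ?_
      obtain ⟨x, hx, hlt⟩ := (lt_isLUB_iff hlub).1 hb
      obtain ⟨z, hz, hbz, hzx⟩ := exists_mem_of_lt_closureIn hlt (ht hx)
      exact ⟨z, ⟨hz, hzx.trans_lt ((hlub.1 hx).lt_of_ne fun h => hβt (h ▸ hx))⟩, hbz⟩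

/-- Sending a point of the closure to the next element of `A` strictly above it is injective, so
closing off adds no cardinality to initial segments. -/
theorem IsThinCofinal.closureIn {lam : Cardinal.{u}} {A : Set Ordinal.{u}} {δ : Ordinal.{u}}
    (hA : IsThinCofinal lam A δ) (hδ : Order.IsSuccLimit δ) :
    IsThinCofinal lam (closureIn A δ) δ := by
  refine ⟨fun _ h => h.1, (isClubIn_closureIn hA.subset hA.exists_ge).exists_ge, fun β hβ => ?_⟩
  obtain ⟨m, hm, hle⟩ := hA.exists_ge β hβ
  refine lt_of_le_of_lt ?_ (hA.mk_lt _ (hδ.succ_lt (hA.subset hm)))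
  have hnext : ∀ x : (ClubGuess.closureIn A δ ∩ Iio β : Set Ordinal.{u}),
      ∃ z : (A ∩ Iio (Order.succ m) : Set Ordinal.{u}),
        x.1 < z.1 ∧ ∀ w ∈ A, x.1 < w → z.1 ≤ w := by
    rintro ⟨x, hx, hxβ⟩
    have hxm : x < m := lt_of_lt_of_le hxβ hle
    obtain ⟨z, hz, hmin⟩ := (wellFounded_lt (α := Ordinal.{u})).has_min {z | z ∈ A ∧ x < z}
      ⟨m, hm, hxm⟩
    exact ⟨⟨z, hz.1, mem_Iio.2 (Order.lt_succ_of_le (not_lt.1 (hmin m ⟨hm, hxm⟩)))⟩, hz.2,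
      fun w hw hxw => not_lt.1 (hmin w ⟨hw, hxw⟩)⟩
  choose g hg hgmin using hnext
  have hmono : StrictMono g := fun x y hxy => by
    obtain ⟨z, hz, hxz, hzy⟩ := exists_mem_of_lt_closureIn (show x.1 < y.1 from hxy) y.2.1
    exact show (g x).1 < (g y).1 from (hgmin x z hz hxz).trans_lt (hzy.trans_lt (hg y))
  exact Cardinal.mk_le_of_injective hmono.injective

/-- A point of cofinality λ is not the supremum of fewer than λ smaller points. -/
theorem IsThinCofinal.subset_nacc_closureIn {lam : Cardinal.{u}} {A : Set Ordinal.{u}}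
    {δ : Ordinal.{u}} (hA : IsThinCofinal lam A δ) (hδ : Order.IsSuccLimit δ)
    (hcof : ∀ α ∈ A, α.cof = lam) : A ⊆ nacc (ClubGuess.closureIn A δ) := by
  refine fun α hα => ⟨subset_closureIn hA.subset hα, fun hacc => ?_⟩
  have hlt := (hA.closureIn hδ).mk_lt α (hA.subset hα)
  rw [← hcof α hα, Ordinal.lift_cof] at hlt
  have h := Ordinal.sSup_lt_of_lt_cof hlt fun i hi => hi.2
  refine absurd (hacc.2.2.2 fun x hx => ?_) (not_le.2 h)
  exact le_csSup ⟨α, fun _ h => h.2.le⟩ hx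

/-- Here `δ` consists of a limit number of blocks of length λ, so two blocks further than the start
of that of `x` is still below `δ`. -/
theorem add_ord_lt_of_dvd {lam : Cardinal.{u}} (hlam : ℵ₀ ≤ lam) {δ x : Ordinal.{u}}
    (hdvd : lam.ord * lam.ord ∣ δ) (hx : x < δ) : x + lam.ord < δ := by
  obtain ⟨ν, rfl⟩ := hdvd
  have hlim := Cardinal.isSuccLimit_ord hlam
  have hpos : lam.ord ≠ 0 := by
    rintro h
    exact not_lt_bot (h ▸ hlim.bot_lt)
  rw [mul_assoc] at hx ⊢
  have hν : 0 < ν := by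
    rcases eq_or_ne ν 0 with rfl | h
    · simp at hx
    · exact pos_iff_ne_zero.2 h
  have hlim' : Order.IsSuccLimit (lam.ord * ν) := Ordinal.isSuccLimit_mul_left hlim hν
  have hdiv : x / lam.ord < lam.ord * ν := (Ordinal.lt_mul_iff_div_lt hpos).1 hx
  calc x + lam.ord ≤ lam.ord * Order.succ (x / lam.ord) + lam.ord := by
        gcongr
        exact (Ordinal.lt_mul_succ_div x hpos).le
    _ = lam.ord * Order.succ (Order.succ (x / lam.ord)) := (Ordinal.mul_succ _ _).symm
    _ < lam.ord * (lam.ord * ν) := by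
        have := hlim'.succ_lt (hlim'.succ_lt hdiv)
        have := pos_iff_ne_zero.2 hpos
        gcongr

/-- A strict club system guessing every club at nonaccumulation points of cofinality `lam`. -/
theorem exists_guessing_strictClubSystem {lam : Cardinal.{u}} (hlam : lam.IsRegular)
    (hlam' : ℵ₀ < lam) {S : Set Ordinal.{u}} (hScof : ∀ δ ∈ S, δ.cof = lam)
    (hSdvd : ∀ δ ∈ S, lam.ord * lam.ord ∣ δ) (hS : IsStationaryIn S (Order.succ lam).ord) :
    ∃ C : Ordinal.{u} → Set Ordinal.{u}, IsStrictClubSystem S C ∧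
      (∀ δ ∈ S, ∀ α ∈ nacc (C δ), α.cof = lam) ∧
      ∀ E, IsClubIn E (Order.succ lam).ord →
        ∃ δ ∈ S, ∀ β < δ, ∃ γ ∈ nacc (C δ) ∩ E, β < γ := by
  choose c hc using exists_isThinCofinal.{u}
  replace hc : ∀ δ ∈ S, IsThinCofinal lam (c δ) δ := fun δ hδ => hScof δ hδ ▸ hc δ
  obtain ⟨e, he⟩ := exists_isLadderSystem lam
  obtain ⟨E, hE⟩ := exists_club_reachable_guessing hlam hlam' hScof hS he hc
  have hlim : ∀ δ ∈ S, Order.IsSuccLimit δ := fun δ hδ => by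
    rw [← Ordinal.one_lt_cof_iff, hScof δ hδ]
    exact Cardinal.one_lt_aleph0.trans hlam'
  -- The translates by λ keep `A δ` cofinal even where the reachable points are bounded, and have
  -- cofinality λ themselves.
  set A : Ordinal.{u} → Set Ordinal.{u} := fun δ =>
    reachable lam e (c δ) E ∪ (fun x => x + lam.ord) '' c δ with hA
  have hAcof : ∀ δ, ∀ α ∈ A δ, α.cof = lam := by
    rintro δ α (h | ⟨x, -, rfl⟩)
    · exact h.1
    · have : lam.ord ≠ 0 := by simpa using hlam.ne_zero
      simp only [Ordinal.cof_add x this, hlam.cof_ord]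
  have hthin : ∀ δ ∈ S, IsThinCofinal lam (A δ) δ := by
    refine fun δ hδ => ⟨union_subset (reachable_subset he (hc δ hδ).subset E) ?_,
      fun β hβ => ?_, fun β hβ => ?_⟩
    · rintro _ ⟨x, hx, rfl⟩
      exact add_ord_lt_of_dvd hlam'.le (hSdvd δ hδ) ((hc δ hδ).subset hx)
    · obtain ⟨α, hα, hle⟩ := (hc δ hδ).exists_ge β hβ
      exact ⟨α + lam.ord, Or.inr ⟨α, hα, rfl⟩, hle.trans le_self_add⟩
    · rw [hA, union_inter_distrib_right]
      refine (Cardinal.mk_union_le _ _).trans_lt (Cardinal.add_lt_of_lt hlam.lift.aleph0_le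
        (mk_reachable_lt hlam he (hlim δ hδ) (hc δ hδ) E hβ) ?_)
      refine lt_of_le_of_lt (Cardinal.mk_le_mk_of_subset
        (t := (fun x => x + lam.ord) '' (c δ ∩ Iio β)) ?_)
        (Cardinal.mk_image_le.trans_lt ((hc δ hδ).mk_lt β hβ))
      rintro _ ⟨⟨x, hx, rfl⟩, hlt⟩
      exact ⟨x, ⟨hx, mem_Iio.2 (lt_of_le_of_lt le_self_add hlt)⟩, rfl⟩
  refine ⟨fun δ => closureIn (A δ) δ, fun δ hδ => ⟨?_, ?_⟩, fun δ hδ α hα => ?_, fun E' hE' => ?_⟩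
  · exact isClubIn_closureIn (hthin δ hδ).subset (hthin δ hδ).exists_ge
  · rw [hScof δ hδ]
    exact ((hthin δ hδ).closureIn (hlim δ hδ)).nonempty_orderIso (hScof δ hδ)
  · exact hAcof δ α (nacc_closureIn_subset (hthin δ hδ).subset hα)
  · obtain ⟨δ, hδ, hguess⟩ := hE E' hE'
    refine ⟨δ, hδ, fun β hβ => ?_⟩
    obtain ⟨γ, hγ, hlt⟩ := hguess β hβ
    exact ⟨γ, ⟨(hthin δ hδ).subset_nacc_closureIn (hlim δ hδ) (hAcof δ) (Or.inl hγ.1), hγ.2⟩, hlt⟩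

/-- A subset of a club `C` of `δ` outside the ideal has nonaccumulating part unbounded in `δ`. -/
theorem isLUB_of_notMem_bddAccIdeal {C A : Set Ordinal.{u}} {δ : Ordinal.{u}} (hC : IsClubIn C δ)
    (hδ : Order.IsSuccLimit δ) (hA : A ⊆ C) (hpos : A ∉ bddAccIdeal C) :
    IsLUB (A ∩ nacc C) δ := by
  refine (isLUB_iff_forall_lt fun x hx => hC.1 (hA hx.1)).2 fun β hβ => ?_
  by_contra! hno
  obtain ⟨γ, hγ, hle⟩ := hC.exists_ge (Order.succ β) (hδ.succ_lt hβ)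
  exact hpos ⟨hA, sdiff_subset.trans hA, γ, hγ, fun α hα =>
    (hno α ⟨hα.1, hA hα.1, hα.2⟩).trans_lt (Order.succ_le_iff.1 hle)⟩

theorem exists_positive_of_notMem_idp {θ : Ordinal.{u}} {S : Set Ordinal.{u}}
    {C : Ordinal.{u} → Set Ordinal.{u}} {J : Ordinal.{u} → Set (Set Ordinal.{u})}
    (h : Iio θ ∉ idp θ S C J) (E : Set Ordinal.{u}) (hE : IsClubIn E θ) :
    ∃ δ ∈ S, E ∩ C δ ∉ J δ := by
  by_contra! hno
  exact h ⟨subset_rfl, E, hE, fun δ hδ => hno δ hδ.1⟩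

end ClubGuess

theorem claim3p1 (μ lam : Cardinal.{u}) (hμ : Cardinal.aleph0 ≤ μ) (hlam : lam = Order.succ μ)
    (S : Set Ordinal.{u})
    (hScof : ∀ δ ∈ S, δ.cof = lam)
    (hSdvd : ∀ δ ∈ S, lam.ord * lam.ord ∣ δ)
    (hSstat : ClubGuess.IsStationaryIn S (Order.succ lam).ord) :
    (∃ C : Ordinal.{u} → Set Ordinal.{u},
      ClubGuess.IsStrictClubSystem S C ∧
      Iio (Order.succ lam).ord ∉
        ClubGuess.idp (Order.succ lam).ord S C (fun δ => ClubGuess.bddAccIdeal (C δ)) ∧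
      (∀ δ ∈ S, ∀ α ∈ ClubGuess.nacc (C δ), α.cof = lam) ∧
      ∃ h : Ordinal.{u} → Ordinal.{u} → Ordinal.{u},
        (∀ δ ∈ S, MapsTo (h δ) (C δ) (Iio μ.ord)) ∧
        ∀ E, ClubGuess.IsClubIn E (Order.succ lam).ord →
          ClubGuess.IsStationaryIn
            {δ | δ ∈ S ∧ ∀ ζ < μ.ord,
              IsLUB {α | h δ α = ζ ∧ α ∈ E ∧ α ∈ ClubGuess.nacc (C δ)} δ}
            (Order.succ lam).ord) ∧
    (∀ (C : Ordinal.{u} → Set Ordinal.{u}) (J : Ordinal.{u} → Set (Set Ordinal.{u})),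
      ClubGuess.IsStrictClubSystem S C →
      (∀ δ ∈ S, ClubGuess.IsCompleteIdealOn lam (C δ) (J δ)) →
      (∀ δ ∈ S, ClubGuess.bddAccIdeal (C δ) ⊆ J δ) →
      Iio (Order.succ lam).ord ∉ ClubGuess.idp (Order.succ lam).ord S C J →
      ∃ h : Ordinal.{u} → Ordinal.{u} → Ordinal.{u},
        (∀ δ ∈ S, MapsTo (h δ) (C δ) (Iio μ.ord)) ∧
        ∀ E, ClubGuess.IsClubIn E (Order.succ lam).ord →
          ClubGuess.IsStationaryIn
            {δ | δ ∈ S ∧ δ ∈ ClubGuess.acc E ∧ ∀ γ < μ.ord,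
              {α | α ∈ C δ ∧ h δ α = γ ∧ α ∈ E} ∉ J δ}
            (Order.succ lam).ord) := by
  have hreg : lam.IsRegular := hlam ▸ Cardinal.isRegular_succ hμ
  have hlam' : Cardinal.aleph0 < lam := hlam ▸ hμ.trans_lt (Order.lt_succ μ)
  have hκ : (Order.succ lam).IsRegular := Cardinal.isRegular_succ hreg.aleph0_le
  have hκ' : Cardinal.aleph0 < Order.succ lam := hlam'.trans (Order.lt_succ lam)
  have hlim : ∀ δ ∈ S, Order.IsSuccLimit δ := fun δ hδ => by
    rw [← Ordinal.one_lt_cof_iff, hScof δ hδ]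
    exact Cardinal.one_lt_aleph0.trans hlam'
  have key : ∀ (C : Ordinal.{u} → Set Ordinal.{u}) (J : Ordinal.{u} → Set (Set Ordinal.{u})),
      ClubGuess.IsStrictClubSystem S C →
      (∀ δ ∈ S, ClubGuess.IsCompleteIdealOn lam (C δ) (J δ)) →
      (∀ δ ∈ S, ClubGuess.bddAccIdeal (C δ) ⊆ J δ) →
      Iio (Order.succ lam).ord ∉ ClubGuess.idp (Order.succ lam).ord S C J →
      ∃ h : Ordinal.{u} → Ordinal.{u} → Ordinal.{u},
        (∀ δ ∈ S, MapsTo (h δ) (C δ) (Iio μ.ord)) ∧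
        ∀ E, ClubGuess.IsClubIn E (Order.succ lam).ord →
          ClubGuess.IsStationaryIn
            {δ | δ ∈ S ∧ δ ∈ ClubGuess.acc E ∧ ∀ γ < μ.ord,
              {α | α ∈ C δ ∧ h δ α = γ ∧ α ∈ E} ∉ J δ}
            (Order.succ lam).ord := by
    intro C J hC hJ hbdd hidp
    obtain ⟨h, hlt, hh⟩ := ClubGuess.exists_coloring_positive hμ hlam hScof hSstat.1 hC hJ hbdd
      (ClubGuess.exists_positive_of_notMem_idp hidp)
    exact ⟨h, fun δ _ α _ => hlt δ α,
      fun E hE => ClubGuess.isStationaryIn_coloring_positive hκ hκ' hSstat.1 hJ hh hE⟩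
  refine ⟨?_, key⟩
  obtain ⟨C, hC, hcof, hguess⟩ :=
    ClubGuess.exists_guessing_strictClubSystem hreg hlam' hScof hSdvd hSstat
  have hidp : Iio (Order.succ lam).ord ∉
      ClubGuess.idp (Order.succ lam).ord S C (fun δ => ClubGuess.bddAccIdeal (C δ)) := by
    rintro ⟨-, E, hE, hall⟩
    obtain ⟨δ, hδ, hunb⟩ := hguess E hE
    obtain ⟨-, -, β, hβ, hlt⟩ := hall δ ⟨hδ, hSstat.1 hδ⟩
    obtain ⟨γ, ⟨hγ, hγE⟩, hβγ⟩ := hunb β ((hC δ hδ).1.1 hβ)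
    exact lt_asymm hβγ (hlt γ ⟨⟨hγE, hγ.1⟩, hγ.2⟩)
  obtain ⟨h, hmaps, hh⟩ := key C _ hC
    (fun δ hδ => ClubGuess.isCompleteIdealOn_bddAccIdeal (hC δ hδ).1 (hScof δ hδ))
    (fun _ _ => subset_rfl) hidp
  refine ⟨C, hC, hidp, hcof, h, hmaps, fun E hE => ⟨fun δ hδ => hSstat.1 hδ.1,
    (hh E hE).2.mono fun δ hδ => ⟨hδ.1, fun ζ hζ => ?_⟩⟩⟩
  convert ClubGuess.isLUB_of_notMem_bddAccIdeal (hC _ hδ.1).1 (hlim _ hδ.1) (fun _ h => h.1)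
    (hδ.2.2 ζ hζ) using 1
  ext α
  exact ⟨fun hα => ⟨⟨hα.2.2.1, hα.1, hα.2.1⟩, hα.2.2⟩, fun hα => ⟨hα.1.2.1, hα.1.2.2, hα.2⟩⟩
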